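/- Let $\mathcal T$ be a finite triangulated surface, possibly with boundary, obtained from a finite set $T$ of triangles by glueing some of their sides in pairs (the triangulation need not be regular). Let $V$ and $E$ be its sets of vertices and edges, and let $\theta:E\to[0,\pi)$ and $\Xi:V\to(0,\infty)$. Label the coordinates of $\mathbb R^{6|T|}$ by $\alpha^t_{ij}$ (one for each side $ij$ of each triangle $t\in T$) and $\gamma^t_i$ (one for each corner $i$ of each $t$). Let $\Delta\subset\mathbb R^6$ be the set of all $(\alpha_{12},\alpha_{23},\alpha_{31},\gamma_1,\gamma_2,\gamma_3)$ with all entries positive, $\gamma_1+\gamma_2+\gamma_3=\pi$, and $$\gamma_1+\alpha_{12}+\alpha_{31}<\pi,\qquad \gamma_2+\alpha_{23}+\alpha_{12}<\pi,\qquad \gamma_3+\alpha_{31}+\alpha_{23}<\pi.$$ Let $\mathcal A(\mathcal T,\theta,\Xi)\subset\mathbb R^{6|T|}$ be the set of all $(\alpha,\gamma)$ such that - $(\alpha^t_{ij},\alpha^t_{jk},\alpha^t_{ki},\gamma^t_i,\gamma^t_j,\gamma^t_k)\in\Delta$ for each triangle $t=ijk$; - $\alpha^t_{ij}+\alpha^{t'}_{ji}=\pi-\theta_{ij}$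 for each interior edge $ij$, where $t,t'$ are the triangles on its two sides; - $\theta_{ij}>0$ and $\alpha^t_{ij}=\pi-\theta_{ij}$ for each boundary edge $ij$, where $t$ is the incident triangle; - for each vertex $i$, the sum of the $\gamma$-coordinates of all triangle corners at $i$ equals $\Xi_i$. Let $\Lambda (x)=-\int_0^x\log|2\sin\xi|\,d\xi$, and define $F:\mathbb R^{6|T|}\to\mathbb R$ by $F=\sum_{t=ijk\in T}V(\alpha^t_{ij},\alpha^t_{jk},\alpha^t_{ki},\gamma^t_i,\gamma^t_j,\gamma^t_k)$, where, with indices modulo $3$, $$2V=\sum_{i=1}^{3}\Big(\Lambda (\gamma_i)+\Lambda \big(\tfrac{\pi+\alpha_{i-1,i}-\alpha_{i,i+1}-\gamma_i}{2}\big)+\Lambda \big(\tfrac{\pi-\alpha_{i-1,i}+\alpha_{i,i+1}-\gamma_i}{2}\big)+\Lambda \big(\tfrac{\pi+\alpha_{i-1,i}+\alpha_{i,i+1}-\gamma_i}{2}\big)+\Lambda \big(\tfrac{\pi-\alpha_{i-1,i}-\alpha_{i,i+1}-\gamma_i}{2}\big)\Big).$$ If $\mathcal A(\mathcal T,\theta,\Xi)$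 is non-empty, then the restriction of $F$ to the closure $\overline{\mathcal A(\mathcal T,\theta,\Xi)}$ attains its maximum at a point of $\mathcal A(\mathcal T,\theta,\Xi)$, and at no point of $\overline{\mathcal A(\mathcal T,\theta,\Xi)}\setminus\mathcal A(\mathcal T,\theta,\Xi)$. -/

import Mathlib

/-- An abstract finite triangulated surface, possibly with boundary and not necessarily orientable,
regular or connected, presented as a glueing of the triangles `t : T` along their sides.

The corners of a triangle `t` are `(t, 0)`, `(t, 1)`, `(t, 2)`; its side `(t, k)` joins the corners
`(t, k)` and `(t, k + 1)` (indices modulo 3). A triple `(t, k, b)` is the side `(t, k)` together with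
a direction: from corner `k` to corner `k + 1` if `b = true`, and from `k + 1` to `k` if
`b = false`. A directed side with `glue s = s` is not glued to anything, that is, it lies on the
boundary of the surface. Otherwise `s` is identified with `glue s`, respecting directions. -/
structure TriangulatedSurface (T : Type*) where
  /-- the directed side to which a directed side is glued (itself, for a boundary side) -/
  glue : T × Fin 3 × Bool → T × Fin 3 × Bool
  /-- if `s` is glued to `s'` then `s'` is glued to `s`; so a side is glued to at most one other -/
  glue_glue : ∀ s, glue (glue s) = s
  /-- reversing the direction of both of two glued sides gives glued sides -/
  glue_reverse : ∀ t k b, glue (t, k, !b) =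
    ((glue (t, k, b)).1, (glue (t, k, b)).2.1, !(glue (t, k, b)).2.2)
  /-- no side is folded onto itself -/
  glue_ne_reverse : ∀ t k b, glue (t, k, b) ≠ (t, k, !b)

namespace TriangulatedSurface

variable {T : Type*}

/-- The undirected side underlying a directed side. -/
def side (s : T × Fin 3 × Bool) : T × Fin 3 := (s.1, s.2.1)

/-- The corner at which a directed side starts. -/
def tail (s : T × Fin 3 × Bool) : T × Fin 3 := (s.1, if s.2.2 then s.2.1 else s.2.1 + 1)

/-- The vertices of the surface: corners of triangles, modulo the equivalence relation generated by
the glueing (`Quot` passes to the generated equivalence relation). -/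
def Vertex (S : TriangulatedSurface T) : Type _ :=
  Quot fun c c' : T × Fin 3 => ∃ s, tail s = c ∧ tail (S.glue s) = c'

/-- The edges of the surface: sides of triangles, modulo the glueing. -/
def Edge (S : TriangulatedSurface T) : Type _ :=
  Quot fun e e' : T × Fin 3 => ∃ s, side s = e ∧ side (S.glue s) = e'

/-- The vertex of the surface at a corner of a triangle. -/
def vertex (S : TriangulatedSurface T) (c : T × Fin 3) : S.Vertex := Quot.mk _ c

/-- The edge of the surface containing a side of a triangle. -/
def edge (S : TriangulatedSurface T) (e : T × Fin 3) : S.Edge := Quot.mk _ e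

end TriangulatedSurface

/-- The coordinate space `ℝ⁶` of one triangle: a point `x` stands for
`(α₁₂, α₂₃, α₃₁, γ₁, γ₂, γ₃)`, where, with vertices numbered `0, 1, 2`, `x.1 i` is the angle `α` at
the side joining `i` and `i + 1`, and `x.2 i` is the angle `γ` at the corner `i`. The two sides
meeting at corner `i` are thus the sides `i` and `i + 2`. -/
abbrev TriangleAngles : Type := (Fin 3 → ℝ) × (Fin 3 → ℝ)

/-- The coordinate space `ℝ^(6|T|)`. -/
abbrev AngleSpace (T : Type*) : Type _ := T → TriangleAngles

/-- The set `Δ` of angles of a euclidean triangle decorated with three disjoint vertex circles and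
their orthogonal circle. -/
def Delta : Set TriangleAngles :=
  {x | (∀ i, 0 < x.1 i) ∧ (∀ i, 0 < x.2 i) ∧ x.2 0 + x.2 1 + x.2 2 = Real.pi ∧
    ∀ i, x.2 i + x.1 i + x.1 (i + 2) < Real.pi}

/-- Milnor's Lobachevsky function. -/
noncomputable def lobachevsky (x : ℝ) : ℝ :=
  -∫ ξ in (0 : ℝ)..x, Real.log |2 * Real.sin ξ|

/-- The function `V` of the six angles of a triangle: one half of a sum of fifteen values of the
Lobachevsky function. -/
noncomputable def triangleV (x : TriangleAngles) : ℝ :=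
  (1 / 2) * ∑ i : Fin 3,
    (lobachevsky (x.2 i)
      + lobachevsky ((Real.pi + x.1 (i + 2) - x.1 i - x.2 i) / 2)
      + lobachevsky ((Real.pi - x.1 (i + 2) + x.1 i - x.2 i) / 2)
      + lobachevsky ((Real.pi + x.1 (i + 2) + x.1 i - x.2 i) / 2)
      + lobachevsky ((Real.pi - x.1 (i + 2) - x.1 i - x.2 i) / 2))

/-- The functional `F` on `ℝ^(6|T|)`. -/
noncomputable def functionalF {T : Type*} [Fintype T] (p : AngleSpace T) : ℝ :=
  ∑ t, triangleV (p t)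

open Classical in
/-- The space `A(𝒯, θ, Ξ)` of coherent angle systems. -/
def TriangulatedSurface.coherentAngleSystems {T : Type*} [Fintype T] (S : TriangulatedSurface T)
    (θ : S.Edge → ℝ) (Ξ : S.Vertex → ℝ) : Set (AngleSpace T) :=
  {p | (∀ t, p t ∈ Delta) ∧
    -- interior edges, seen from a directed side `s` and the directed side glued to it
    (∀ s, S.glue s ≠ s →
      (p s.1).1 s.2.1 + (p (S.glue s).1).1 (S.glue s).2.1 =
        Real.pi - θ (S.edge (TriangulatedSurface.side s))) ∧
    -- boundary edges
    (∀ s, S.glue s = s →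
      0 < θ (S.edge (TriangulatedSurface.side s)) ∧
      (p s.1).1 s.2.1 = Real.pi - θ (S.edge (TriangulatedSurface.side s))) ∧
    -- vertices: the sum is over all corners of triangles at the vertex `v`
    (∀ v : S.Vertex, ∑ c : T × Fin 3 with S.vertex c = v, (p c.1).2 c.2 = Ξ v)}

/-!
The closure of the set `A` of coherent angle systems is obtained by making its inequalities
non-strict (`closure_coherentAngleSystems`), and it is compact, so the continuous functional has a
maximum there. It remains to leave each point `q` of the closure outside `A` in a direction that
increases the functional (`exists_functionalF_gt`).

At a multiple of `π` the Lobachevsky function behaves like `-δ log |δ|`, and it is smooth elsewhere.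
Hence the difference quotient at `0` of `ε ↦ triangleV (x + ε • v)` is `-K log ε + R + o(1)`, where
the divergent part `K` and the finite part `R` are sums over the fifteen arguments of the Lobachevsky
function (`tendsto_triangleV_slope`). Take `v = p - q` with `p ∈ A`. Then `K` is positive for every
triangle on the boundary of `Delta` (`triangleSum_lobLogPart_pos`), with two exceptions, for which
`K = 0`: *nondegenerate* triangles, where only some angles `α` vanish, and *collapsed* triangles,
where one `α` and the opposite `γ` are `π` and all other angles vanish. So if `q` has another
kind of boundary triangle, the derivative towards `p` is `+∞`.

Otherwise all derivatives are finite. The function `triangleV` is even in each `α`, so at a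
nondegenerate triangle increasing an angle `α = 0` costs nothing to first order, whereas decreasing a
positive `α` is a gain (`sidePartial_of_alpha_eq_zero`, `sidePartial_neg`). If no triangle
is collapsed, some `α` vanishes, its edge is interior since `θ < π`, and shifting angle to it from
the other side of the edge increases the functional. If there are collapsed triangles, then one of
them has a nondegenerate neighbour, with `α = 0`, across its side with angle `π`
(`exists_isCollapsed_glue_isNondegenerate`; that side is interior since `θ > 0` on the boundary).
Moving towards `p` and at the same time shifting angle across this edge at speed `W` gives a finite
derivative that tends to `∞` with `W` (`tendsto_triangleSum_lobFinitePart_of_isCollapsed`).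
-/

open Filter Topology

/-! ### The Lobachevsky function near its singular points -/

lemma intervalIntegrable_log_abs_two_sin (a b : ℝ) :
    IntervalIntegrable (fun ξ => Real.log |2 * Real.sin ξ|) MeasureTheory.volume a b := by
  have h : MeromorphicOn (fun ξ : ℝ => 2 * Real.sin ξ) (Set.uIcc a b) := by
    intro x _
    have : AnalyticAt ℝ (fun ξ : ℝ => 2 * Real.sin ξ) x := by fun_prop
    exact this.meromorphicAt
  simpa [Real.norm_eq_abs] using h.intervalIntegrable_log_norm

lemma lobachevsky_sub (z w : ℝ) :
    lobachevsky w - lobachevsky z = -∫ ξ in z..w, Real.log |2 * Real.sin ξ| := by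
  unfold lobachevsky
  rw [← intervalIntegral.integral_interval_sub_left
    (intervalIntegrable_log_abs_two_sin 0 w) (intervalIntegrable_log_abs_two_sin 0 z)]
  ring

lemma continuous_lobachevsky : Continuous lobachevsky :=
  (intervalIntegral.continuous_primitive intervalIntegrable_log_abs_two_sin 0).neg

/-- The increments of `lobachevsky` at a multiple of `π` are those at `0`. -/
lemma lobachevsky_add_sub_of_sin_eq_zero {z : ℝ} (hz : Real.sin z = 0) (δ : ℝ) :
    lobachevsky (z + δ) - lobachevsky z = lobachevsky δ := by
  rw [lobachevsky_sub, lobachevsky]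
  have h := intervalIntegral.integral_comp_add_left
    (fun ξ => Real.log |2 * Real.sin ξ|) (a := 0) (b := δ) z
  rw [add_zero] at h
  rw [← h]
  congr 1
  refine intervalIntegral.integral_congr fun ξ _ => ?_
  have hc : |Real.cos z| = 1 := by
    have := Real.sin_sq_add_cos_sq z
    rw [hz] at this
    rw [← Real.sqrt_sq_eq_abs]
    simp only [ne_eq, OfNat.ofNat_ne_zero, not_false_eq_true, zero_pow, zero_add] at this
    rw [this, Real.sqrt_one]
  simp only [Real.sin_add, hz, zero_mul, zero_add, abs_mul, hc, one_mul]

lemma hasDerivAt_lobachevsky {z : ℝ} (hz : Real.sin z ≠ 0) :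
    HasDerivAt lobachevsky (-Real.log |2 * Real.sin z|) z := by
  refine (intervalIntegral.integral_hasDerivAt_right (intervalIntegrable_log_abs_two_sin 0 z)
    ?_ ?_).neg
  · exact (Measurable.stronglyMeasurable (by fun_prop)).stronglyMeasurableAtFilter
  · exact ContinuousAt.log (by fun_prop) (by simpa using hz)

/-- Near `0`, the Lobachevsky function is `δ - δ log |2 δ|` up to the primitive of `log |sinc|`,
which is `o(δ)`. -/
lemma lobachevsky_eq_of_abs_lt_pi {δ : ℝ} (hδ : |δ| < Real.pi) :
    lobachevsky δ = δ - δ * Real.log (2 * δ) - ∫ ξ in (0 : ℝ)..δ, Real.log |Real.sinc ξ| := by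
  have hlog : IntervalIntegrable (fun ξ : ℝ => Real.log (2 * ξ)) MeasureTheory.volume 0 δ := by
    have h : MeromorphicOn (fun ξ : ℝ => 2 * ξ) (Set.uIcc 0 δ) := by
      intro x _
      have : AnalyticAt ℝ (fun ξ : ℝ => 2 * ξ) x := by fun_prop
      exact this.meromorphicAt
    simpa only [Real.norm_eq_abs, Real.log_abs] using h.intervalIntegrable_log_norm
  have hval : ∫ ξ in (0 : ℝ)..δ, Real.log (2 * ξ) = δ * Real.log (2 * δ) - δ := by
    rw [intervalIntegral.integral_comp_mul_left (fun x => Real.log x) two_ne_zero, integral_log]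
    simp only [mul_zero, Real.log_zero, smul_eq_mul]
    ring
  have hdiff : ∫ ξ in (0 : ℝ)..δ, Real.log |Real.sinc ξ|
      = (∫ ξ in (0 : ℝ)..δ, Real.log |2 * Real.sin ξ|) - ∫ ξ in (0 : ℝ)..δ, Real.log (2 * ξ) := by
    rw [← intervalIntegral.integral_sub (intervalIntegrable_log_abs_two_sin 0 δ) hlog]
    refine intervalIntegral.integral_congr fun ξ hξ => ?_
    have hξ' : |ξ| < Real.pi := by
      have := Set.abs_sub_left_of_mem_uIcc hξ
      simp only [sub_zero] at this
      linarith
    rcases eq_or_ne ξ 0 with rfl | h0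
    · simp
    · have hs : Real.sin ξ ≠ 0 := by
        rw [abs_lt] at hξ'
        rwa [Ne, Real.sin_eq_zero_iff_of_lt_of_lt hξ'.1 hξ'.2]
      simp only [Real.log_abs]
      rw [Real.sinc_of_ne_zero h0, Real.log_div hs h0, Real.log_mul two_ne_zero hs,
        Real.log_mul two_ne_zero h0]
      ring
  rw [hdiff, hval, lobachevsky]
  ring

/-- The finite part of the one-sided derivative of `ε ↦ lobachevsky (z + c * ε)` at `0`: the
derivative itself if `z` is not a multiple of `π`, and what is left of it after the divergent term
`-c * log ε` is removed if it is. -/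
noncomputable def lobFinitePart (z c : ℝ) : ℝ :=
  if Real.sin z = 0 then c - c * Real.log (2 * c) else -(c * Real.log |2 * Real.sin z|)

/-- The coefficient of `-log ε` in the one-sided difference quotient of
`ε ↦ lobachevsky (z + c * ε)` at `0`. -/
noncomputable def lobLogPart (z c : ℝ) : ℝ :=
  if Real.sin z = 0 then c else 0

lemma tendsto_lobachevsky_slope (z c : ℝ) :
    Tendsto (fun ε : ℝ => (lobachevsky (z + c * ε) - lobachevsky z) / ε
      + lobLogPart z c * Real.log ε) (𝓝[>] 0) (𝓝 (lobFinitePart z c)) := by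
  have hpos : ∀ᶠ ε : ℝ in 𝓝[>] 0, 0 < ε := eventually_mem_nhdsWithin
  by_cases hz : Real.sin z = 0
  · simp only [lobLogPart, lobFinitePart, if_pos hz]
    have hder : HasDerivAt (fun δ => ∫ ξ in (0 : ℝ)..δ, Real.log |Real.sinc ξ|) 0 0 := by
      have hc := Real.continuous_sinc
      have := intervalIntegral.integral_hasDerivAt_right (a := (0 : ℝ)) (b := 0)
        (f := fun ξ => Real.log |Real.sinc ξ|) (by simp)
        (Measurable.stronglyMeasurable (by
          have := hc.measurable
          fun_prop)).stronglyMeasurableAtFilter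
        (ContinuousAt.log (by fun_prop) (by simp))
      simpa using this
    have hcomp : HasDerivAt (fun ε => ∫ ξ in (0 : ℝ)..(c * ε), Real.log |Real.sinc ξ|) 0 0 := by
      have h1 : HasDerivAt (fun ε : ℝ => c * ε) c 0 := by
        simpa using (hasDerivAt_id (0 : ℝ)).const_mul c
      have h2 := HasDerivAt.comp (0 : ℝ) (h := fun ε : ℝ => c * ε) (by simpa using hder) h1
      simpa [Function.comp_def] using h2
    have ht := (hasDerivAt_iff_tendsto_slope.mp hcomp).mono_left
      (nhdsWithin_mono 0 (t := {0}ᶜ) (s := Set.Ioi (0 : ℝ)) (fun x hx => ne_of_gt hx))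
    have hsmall : ∀ᶠ ε : ℝ in 𝓝[>] 0, |c * ε| < Real.pi := by
      have : Tendsto (fun ε : ℝ => |c * ε|) (𝓝 0) (𝓝 |c * 0|) := by
        apply Continuous.tendsto; fun_prop
      refine (this.eventually (gt_mem_nhds ?_)).filter_mono nhdsWithin_le_nhds
      simpa using Real.pi_pos
    have ht2 := (tendsto_const_nhds (x := c - c * Real.log (2 * c))).sub ht
    rw [sub_zero] at ht2
    refine ht2.congr' ?_
    filter_upwards [hpos, hsmall] with ε hε hs
    rw [lobachevsky_add_sub_of_sin_eq_zero hz, lobachevsky_eq_of_abs_lt_pi hs, slope_def_field]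
    rcases eq_or_ne c 0 with rfl | hc
    · simp
    · rw [← mul_assoc, Real.log_mul (mul_ne_zero two_ne_zero hc) hε.ne']
      simp only [mul_zero, intervalIntegral.integral_same, sub_zero]
      field_simp
      ring
  · simp only [lobLogPart, lobFinitePart, if_neg hz, zero_mul, add_zero]
    have h1 : HasDerivAt (fun ε : ℝ => z + c * ε) c 0 := by
      simpa using ((hasDerivAt_id (0 : ℝ)).const_mul c).const_add z
    have h2 := HasDerivAt.comp (0 : ℝ) (h := fun ε : ℝ => z + c * ε)
      (by simpa only [mul_zero, add_zero] using hasDerivAt_lobachevsky hz) h1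
    have ht := (hasDerivAt_iff_tendsto_slope.mp h2).mono_left
      (nhdsWithin_mono 0 (t := {0}ᶜ) (s := Set.Ioi (0 : ℝ)) (fun x hx => ne_of_gt hx))
    have he : -(c * Real.log |2 * Real.sin z|) = -Real.log |2 * Real.sin z| * c := by ring
    rw [he]
    refine ht.congr fun ε => ?_
    simp [slope_def_field]

/-! ### One-sided derivatives of `triangleV` -/

/-- The sum of `f z z'` over the five arguments `z` of the Lobachevsky function that belong to a
corner with angle `γ` between sides with angles `a` and `b`; here `z'` is the derivative of `z` in
the direction `(γ', a', b')`. -/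
noncomputable def cornerSum (f : ℝ → ℝ → ℝ) (γ a b γ' a' b' : ℝ) : ℝ :=
  f γ γ' + f ((Real.pi + a - b - γ) / 2) ((a' - b' - γ') / 2)
    + f ((Real.pi - a + b - γ) / 2) ((-a' + b' - γ') / 2)
    + f ((Real.pi + a + b - γ) / 2) ((a' + b' - γ') / 2)
    + f ((Real.pi - a - b - γ) / 2) ((-a' - b' - γ') / 2)

/-- Half the sum of `f z z'` over the fifteen arguments `z` of the Lobachevsky function in
`triangleV x`, where `z'` is the derivative of `z` in the direction `v`. -/
noncomputable def triangleSum (f : ℝ → ℝ → ℝ) (x v : TriangleAngles) : ℝ :=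
  (1 / 2) * ∑ i : Fin 3, cornerSum f (x.2 i) (x.1 (i + 2)) (x.1 i) (v.2 i) (v.1 (i + 2)) (v.1 i)

lemma continuous_triangleV : Continuous triangleV := by
  have := continuous_lobachevsky
  unfold triangleV
  fun_prop

lemma tendsto_triangleV_slope (x v : TriangleAngles) :
    Tendsto (fun ε : ℝ => (triangleV (x + ε • v) - triangleV x) / ε
      + triangleSum lobLogPart x v * Real.log ε) (𝓝[>] 0)
      (𝓝 (triangleSum lobFinitePart x v)) := by
  have hcorner (γ a b γ' a' b' : ℝ) := ((((tendsto_lobachevsky_slope γ γ').add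
    (tendsto_lobachevsky_slope ((Real.pi + a - b - γ) / 2) ((a' - b' - γ') / 2))).add
    (tendsto_lobachevsky_slope ((Real.pi - a + b - γ) / 2) ((-a' + b' - γ') / 2))).add
    (tendsto_lobachevsky_slope ((Real.pi + a + b - γ) / 2) ((a' + b' - γ') / 2))).add
    (tendsto_lobachevsky_slope ((Real.pi - a - b - γ) / 2) ((-a' - b' - γ') / 2))
  have hsum := (tendsto_finsetSum (Finset.univ : Finset (Fin 3)) fun i _ =>
    hcorner (x.2 i) (x.1 (i + 2)) (x.1 i) (v.2 i) (v.1 (i + 2)) (v.1 i)).const_mul (1 / 2)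
  refine hsum.congr fun ε => ?_
  unfold triangleV triangleSum cornerSum
  rw [← mul_sub, mul_div_assoc, mul_assoc, ← mul_add, ← Finset.sum_sub_distrib, Finset.sum_div,
    Finset.sum_mul, ← Finset.sum_add_distrib]
  congr 1
  refine Finset.sum_congr rfl fun i _ => ?_
  have e1 : (x + ε • v).2 i = x.2 i + v.2 i * ε := by simp [mul_comm]
  have e2 (j : Fin 3) : (x + ε • v).1 j = x.1 j + v.1 j * ε := by simp [mul_comm]
  rw [e1, e2, e2]
  generalize x.2 i = γ
  generalize x.1 i = b
  generalize x.1 (i + 2) = a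
  generalize v.2 i = γ'
  generalize v.1 i = b'
  generalize v.1 (i + 2) = a'
  rw [show (Real.pi + (a + a' * ε) - (b + b' * ε) - (γ + γ' * ε)) / 2
      = (Real.pi + a - b - γ) / 2 + (a' - b' - γ') / 2 * ε by ring,
    show (Real.pi - (a + a' * ε) + (b + b' * ε) - (γ + γ' * ε)) / 2
      = (Real.pi - a + b - γ) / 2 + (-a' + b' - γ') / 2 * ε by ring,
    show (Real.pi + (a + a' * ε) + (b + b' * ε) - (γ + γ' * ε)) / 2
      = (Real.pi + a + b - γ) / 2 + (a' + b' - γ') / 2 * ε by ring,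
    show (Real.pi - (a + a' * ε) - (b + b' * ε) - (γ + γ' * ε)) / 2
      = (Real.pi - a - b - γ) / 2 + (-a' - b' - γ') / 2 * ε by ring]
  ring

/-! ### The divergent part of the derivative -/

lemma lobLogPart_of_mem_Ioo {z : ℝ} (h0 : 0 < z) (h1 : z < Real.pi) (c : ℝ) :
    lobLogPart z c = 0 :=
  if_neg (Real.sin_pos_of_pos_of_lt_pi h0 h1).ne'

lemma lobLogPart_of_eq_zero {z : ℝ} (h : z = 0) (c : ℝ) : lobLogPart z c = c :=
  if_pos (by simp [h])

lemma lobLogPart_of_eq_pi {z : ℝ} (h : z = Real.pi) (c : ℝ) : lobLogPart z c = c :=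
  if_pos (by simp [h])

lemma cornerSum_lobLogPart_of_pos {γ a b : ℝ} (hγ : 0 < γ) (ha : 0 ≤ a) (hb : 0 ≤ b)
    (hs : γ + b + a < Real.pi) (γ' a' b' : ℝ) : cornerSum lobLogPart γ a b γ' a' b' = 0 := by
  unfold cornerSum
  rw [lobLogPart_of_mem_Ioo hγ (by linarith), lobLogPart_of_mem_Ioo (by linarith) (by linarith),
    lobLogPart_of_mem_Ioo (by linarith) (by linarith),
    lobLogPart_of_mem_Ioo (by linarith) (by linarith),
    lobLogPart_of_mem_Ioo (by linarith) (by linarith)]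
  ring

lemma cornerSum_lobLogPart_of_gamma_eq_zero {γ a b : ℝ} (hγ : γ = 0) (ha : 0 ≤ a) (hb : 0 ≤ b)
    (hs : γ + b + a < Real.pi) (γ' a' b' : ℝ) : cornerSum lobLogPart γ a b γ' a' b' = γ' := by
  unfold cornerSum
  rw [lobLogPart_of_eq_zero hγ, lobLogPart_of_mem_Ioo (by linarith) (by linarith),
    lobLogPart_of_mem_Ioo (by linarith) (by linarith),
    lobLogPart_of_mem_Ioo (by linarith) (by linarith),
    lobLogPart_of_mem_Ioo (by linarith) (by linarith)]
  ring

/-- The arguments `γ = 0`, `(π + a + b - γ) / 2 = π` and `(π - a - b - γ) / 2 = 0` are singular, and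
their contributions cancel. -/
lemma cornerSum_lobLogPart_of_gamma_eq_zero_of_tight {γ a b : ℝ} (hγ : γ = 0) (ha : 0 < a)
    (hb : 0 < b) (hs : γ + b + a = Real.pi) (γ' a' b' : ℝ) :
    cornerSum lobLogPart γ a b γ' a' b' = 0 := by
  unfold cornerSum
  rw [lobLogPart_of_eq_zero hγ, lobLogPart_of_mem_Ioo (by linarith) (by linarith),
    lobLogPart_of_mem_Ioo (by linarith) (by linarith),
    lobLogPart_of_eq_pi (by linarith), lobLogPart_of_eq_zero (by linarith)]
  ring

/-- At a corner with positive angle at which the strict inequality of `Delta` becomes an equality,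
the divergent part of the derivative towards `Delta` is positive. -/
lemma cornerSum_lobLogPart_pos_of_tight {γ a b : ℝ} (hγ : 0 < γ) (ha : 0 ≤ a) (hb : 0 ≤ b)
    (hs : γ + b + a = Real.pi) {γ₁ a₁ b₁ : ℝ} (ha₁ : 0 < a₁) (hb₁ : 0 < b₁)
    (hs₁ : γ₁ + b₁ + a₁ < Real.pi) :
    0 < cornerSum lobLogPart γ a b (γ₁ - γ) (a₁ - a) (b₁ - b) := by
  unfold cornerSum
  rcases ha.eq_or_lt with ha | ha <;> rcases hb.eq_or_lt with hb | hb
  · rw [lobLogPart_of_eq_pi (by linarith), lobLogPart_of_eq_zero (by linarith),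
      lobLogPart_of_eq_zero (by linarith), lobLogPart_of_eq_zero (by linarith),
      lobLogPart_of_eq_zero (by linarith)]
    linarith
  · rw [lobLogPart_of_mem_Ioo (by linarith) (by linarith), lobLogPart_of_eq_zero (by linarith),
      lobLogPart_of_mem_Ioo (by linarith) (by linarith),
      lobLogPart_of_mem_Ioo (by linarith) (by linarith), lobLogPart_of_eq_zero (by linarith)]
    linarith
  · rw [lobLogPart_of_mem_Ioo (by linarith) (by linarith),
      lobLogPart_of_mem_Ioo (by linarith) (by linarith), lobLogPart_of_eq_zero (by linarith),
      lobLogPart_of_mem_Ioo (by linarith) (by linarith), lobLogPart_of_eq_zero (by linarith)]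
    linarith
  · rw [lobLogPart_of_mem_Ioo (by linarith) (by linarith),
      lobLogPart_of_mem_Ioo (by linarith) (by linarith),
      lobLogPart_of_mem_Ioo (by linarith) (by linarith),
      lobLogPart_of_mem_Ioo (by linarith) (by linarith), lobLogPart_of_eq_zero (by linarith)]
    linarith

/-- The set cut out by the non-strict versions of the inequalities that define `Delta`. -/
def weakDelta : Set TriangleAngles :=
  {x | (∀ i, 0 ≤ x.1 i) ∧ (∀ i, 0 ≤ x.2 i) ∧ x.2 0 + x.2 1 + x.2 2 = Real.pi ∧
    ∀ i, x.2 i + x.1 i + x.1 (i + 2) ≤ Real.pi}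

/-- All inequalities of `Delta` that involve an angle `γ` are strict. A point of `weakDelta` with
this property lies in `Delta` unless some `α` vanishes. -/
def IsNondegenerate (x : TriangleAngles) : Prop :=
  ∀ i, 0 < x.2 i ∧ x.2 i + x.1 i + x.1 (i + 2) < Real.pi

/-- The triangle is collapsed along the side `k`: the angle at this side and the angle at the
opposite corner `k + 2` are `π`, and the other angles vanish. -/
def IsCollapsed (x : TriangleAngles) (k : Fin 3) : Prop :=
  x.1 k = Real.pi ∧ x.1 (k + 1) = 0 ∧ x.1 (k + 2) = 0 ∧
    x.2 k = 0 ∧ x.2 (k + 1) = 0 ∧ x.2 (k + 2) = Real.pi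

lemma fin_three_add_one_add_two (i : Fin 3) : i + 1 + 2 = i := by fin_cases i <;> rfl

lemma fin_three_add_two_add_two (i : Fin 3) : i + 2 + 2 = i + 1 := by fin_cases i <;> rfl

lemma sum_fin_three_rotate {M : Type*} [AddCommMonoid M] (f : Fin 3 → M) (k : Fin 3) :
    ∑ i, f i = f k + f (k + 1) + f (k + 2) := by
  rw [Fin.sum_univ_three]
  fin_cases k
  · rfl
  · change f 0 + f 1 + f 2 = f 1 + f 2 + f 0
    rw [add_assoc, add_comm]
  · change f 0 + f 1 + f 2 = f 2 + f 0 + f 1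
    rw [add_comm, add_assoc]

lemma weakDelta_sum_gamma {x : TriangleAngles} (hx : x ∈ weakDelta) (k : Fin 3) :
    x.2 k + x.2 (k + 1) + x.2 (k + 2) = Real.pi := by
  rw [← sum_fin_three_rotate x.2 k, Fin.sum_univ_three]
  exact hx.2.2.1

lemma Delta_subset_weakDelta : Delta ⊆ weakDelta := fun _ hx =>
  ⟨fun i => (hx.1 i).le, fun i => (hx.2.1 i).le, hx.2.2.1, fun i => (hx.2.2.2 i).le⟩

lemma isCollapsed_of_alpha_eq_pi {x : TriangleAngles} (hx : x ∈ weakDelta) {k : Fin 3}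
    (hk : x.1 k = Real.pi) : IsCollapsed x k := by
  have h1 := hx.2.2.2 k
  have h2 := hx.2.2.2 (k + 1)
  rw [fin_three_add_one_add_two] at h2
  have hs := weakDelta_sum_gamma hx k
  have a1 := hx.1 (k + 1)
  have a2 := hx.1 (k + 2)
  have g0 := hx.2.1 k
  have g1 := hx.2.1 (k + 1)
  refine ⟨hk, ?_, ?_, ?_, ?_, ?_⟩ <;> linarith

/-- If a triangle of `weakDelta` is neither nondegenerate nor collapsed, then the derivative of
`triangleV` towards `Delta` is `+∞`. -/
lemma triangleSum_lobLogPart_pos {x p : TriangleAngles} (hx : x ∈ weakDelta) (hp : p ∈ Delta)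
    (hr : ¬ IsNondegenerate x) (hc : ∀ k, ¬ IsCollapsed x k) :
    0 < triangleSum lobLogPart x (p - x) := by
  obtain ⟨ha, hγ, hsum, hs⟩ := hx
  obtain ⟨pa, pγ, -, ps⟩ := hp
  have htight {i : Fin 3} (h1 : 0 < x.2 i) (h2 : x.2 i + x.1 i + x.1 (i + 2) = Real.pi) :=
    cornerSum_lobLogPart_pos_of_tight h1 (ha (i + 2)) (ha i) h2 (pa (i + 2)) (pa i) (ps i)
  have hpos {i : Fin 3} (h1 : x.2 i = 0) (h2 : x.2 i + x.1 i + x.1 (i + 2) = Real.pi) :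
      0 < x.1 (i + 2) ∧ 0 < x.1 i := by
    refine ⟨(ha _).lt_of_ne' fun h => hc i ?_, (ha _).lt_of_ne' fun h => hc (i + 2) ?_⟩ <;>
    exact isCollapsed_of_alpha_eq_pi ⟨ha, hγ, hsum, hs⟩ (by linarith)
  set K : Fin 3 → ℝ := fun i => cornerSum lobLogPart (x.2 i) (x.1 (i + 2)) (x.1 i)
    (p.2 i - x.2 i) (p.1 (i + 2) - x.1 (i + 2)) (p.1 i - x.1 i) with hK
  have hnonneg (i : Fin 3) : 0 ≤ K i := by
    rcases (hγ i).eq_or_lt with h1 | h1 <;> rcases (hs i).eq_or_lt with h2 | h2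
    · obtain ⟨h3, h4⟩ := hpos h1.symm h2
      exact (cornerSum_lobLogPart_of_gamma_eq_zero_of_tight h1.symm h3 h4 h2 _ _ _).ge
    · simp only [hK]
      rw [cornerSum_lobLogPart_of_gamma_eq_zero h1.symm (ha _) (ha _) h2]
      linarith [pγ i]
    · exact (htight h1 h2).le
    · exact (cornerSum_lobLogPart_of_pos h1 (ha _) (ha _) h2 _ _ _).ge
  have hex : ∃ i, 0 < K i := by
    unfold IsNondegenerate at hr
    push Not at hr
    obtain ⟨i, hi⟩ := hr
    rcases (hγ i).eq_or_lt with h1 | h1 <;> rcases (hs i).eq_or_lt with h2 | h2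
    · -- Here `α i + α (i + 2) = π`, which forces the next corner to be tight with positive angle.
      obtain ⟨h3, h4⟩ := hpos h1.symm h2
      have e1 := hs (i + 1)
      have e2 := hs (i + 2)
      rw [fin_three_add_one_add_two] at e1
      rw [fin_three_add_two_add_two] at e2
      have e3 := weakDelta_sum_gamma (x := x) ⟨ha, hγ, hsum, hs⟩ i
      have e4 := ha (i + 1)
      refine ⟨i + 1, htight (by linarith) ?_⟩
      rw [fin_three_add_one_add_two]
      linarith
    · refine ⟨i, ?_⟩
      simp only [hK]
      rw [cornerSum_lobLogPart_of_gamma_eq_zero h1.symm (ha _) (ha _) h2]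
      linarith [pγ i]
    · exact ⟨i, htight h1 h2⟩
    · exact absurd h2 (not_lt.mpr (hi h1))
  obtain ⟨i, hi⟩ := hex
  exact mul_pos (by norm_num) (Finset.sum_pos' (fun j _ => hnonneg j) ⟨i, Finset.mem_univ i, hi⟩)

lemma triangleSum_lobLogPart_of_isNondegenerate {x : TriangleAngles} (hx : x ∈ weakDelta)
    (hr : IsNondegenerate x) (v : TriangleAngles) : triangleSum lobLogPart x v = 0 := by
  unfold triangleSum
  rw [Finset.sum_eq_zero, mul_zero]
  exact fun i _ => cornerSum_lobLogPart_of_pos (hr i).1 (hx.1 _) (hx.1 _) (hr i).2 _ _ _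

/-- Every argument of the Lobachevsky function in `triangleV x` is `0` or `π` if `x` is
collapsed. -/
lemma triangleSum_of_isCollapsed {x : TriangleAngles} {k : Fin 3} (hx : IsCollapsed x k)
    {f : ℝ → ℝ → ℝ} {g : ℝ → ℝ} (h0 : ∀ c, f 0 c = g c) (hpi : ∀ c, f Real.pi c = g c)
    (v : TriangleAngles) :
    triangleSum f x v = triangleSum (fun _ c => g c) x v := by
  obtain ⟨a0, a1, a2, g0, g1, g2⟩ := hx
  unfold triangleSum
  rw [sum_fin_three_rotate _ k, sum_fin_three_rotate _ k]
  simp only [cornerSum, fin_three_add_one_add_two, fin_three_add_two_add_two, a0, a1, a2, g0, g1,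
    g2, add_zero, sub_zero, sub_self, zero_div, add_self_div_two, h0, hpi]

lemma triangleSum_lobLogPart_of_isCollapsed {x : TriangleAngles} {k : Fin 3}
    (hx : IsCollapsed x k) {v : TriangleAngles} (hv : v.2 0 + v.2 1 + v.2 2 = 0) :
    triangleSum lobLogPart x v = 0 := by
  rw [triangleSum_of_isCollapsed hx (g := fun c => c) (fun c => lobLogPart_of_eq_zero rfl c)
    (fun c => lobLogPart_of_eq_pi rfl c)]
  unfold triangleSum cornerSum
  rw [Fin.sum_univ_three]
  linarith

/-! ### The finite part of the derivative at a collapsed triangle -/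

/-- `lobFinitePart 0`, the finite part at a multiple of `π`, is an odd function `r` with
`r u - r (u + d) → ∞` as `u → ∞`, for `d > 0`. -/
lemma tendsto_entropy_sub {d : ℝ} (hd : 0 < d) :
    Tendsto (fun u : ℝ => (u - u * Real.log (2 * u))
      - ((u + d) - (u + d) * Real.log (2 * (u + d)))) atTop atTop := by
  have h1 : Tendsto (fun u : ℝ => d * Real.log (2 * u) - d) atTop atTop := by
    refine tendsto_atTop_add_const_right _ (-d) ?_
    exact (Real.tendsto_log_atTop.comp (tendsto_id.const_mul_atTop two_pos)).const_mul_atTop hd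
  refine tendsto_atTop_mono' _ ?_ h1
  filter_upwards [eventually_gt_atTop 0] with u hu
  have h2 : Real.log (2 * u) ≤ Real.log (2 * (u + d)) :=
    Real.log_le_log (by linarith) (by linarith)
  have := mul_le_mul_of_nonneg_left h2 (by linarith : 0 ≤ u + d)
  linarith

/-- At a collapsed triangle, the derivative of `triangleV` in a direction that opens the corners `k`
and `k + 1` becomes arbitrarily large when the angle at the side `k` decreases fast enough. -/
lemma tendsto_triangleSum_lobFinitePart_of_isCollapsed {x : TriangleAngles} {k : Fin 3}
    (hx : IsCollapsed x k) {v : TriangleAngles} (h0 : 0 < v.2 k) (h1 : 0 < v.2 (k + 1)) :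
    Tendsto (fun W : ℝ => triangleSum lobFinitePart x (v - W • (Pi.single k 1, 0))) atTop atTop := by
  set r : ℝ → ℝ := fun c => c - c * Real.log (2 * c) with hr
  have hodd (c : ℝ) : r (-c) = -r c := by
    simp only [hr, mul_neg, Real.log_neg_eq_log]; ring
  have key {x₀ : ℝ} (hx₀ : 0 < x₀) (a w : ℝ) :
      Tendsto (fun W : ℝ => (r ((a + (W - w) - x₀) / 2) - r ((a + (W - w) - x₀) / 2 + x₀))
        + (r ((-a + (W - w) - x₀) / 2) - r ((-a + (W - w) - x₀) / 2 + x₀))) atTop atTop := by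
    have hlin (c : ℝ) : Tendsto (fun W : ℝ => (c + (W - w) - x₀) / 2) atTop atTop := by
      have := (tendsto_atTop_add_const_right atTop (c - w - x₀)
        (tendsto_id (α := ℝ))).atTop_div_const (two_pos (α := ℝ))
      exact this.congr fun W => by simp only [id]; ring
    exact ((tendsto_entropy_sub hx₀).comp (hlin a)).atTop_add_atTop
      ((tendsto_entropy_sub hx₀).comp (hlin (-a)))
  have hlim := (((key h0 (v.1 (k + 2)) (v.1 k)).atTop_add_atTop
    (key h1 (v.1 (k + 1)) (v.1 k))).const_mul_atTop (one_half_pos (α := ℝ)))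
  refine (tendsto_atTop_add_const_right atTop ((1 / 2) * (r (v.2 k) + r (v.2 (k + 1))
    + cornerSum (fun _ c => r c) 0 0 0 (v.2 (k + 2)) (v.1 (k + 1)) (v.1 (k + 2)))) hlim).congr
    fun W => ?_
  -- As `r` is odd, the terms that involve `W` pair up to differences `r u - r (u + x₀)`, where `x₀` is
  -- the speed at which one of the corners `k`, `k + 1` opens, and `u → ∞` as `W → ∞`.
  rw [triangleSum_of_isCollapsed hx (g := r) (fun c => if_pos Real.sin_zero)
    (fun c => if_pos Real.sin_pi)]
  unfold triangleSum
  rw [sum_fin_three_rotate _ k]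
  have n1 : k + 1 ≠ k := by fin_cases k <;> decide
  have n2 : k + 2 ≠ k := by fin_cases k <;> decide
  simp only [cornerSum, fin_three_add_one_add_two, fin_three_add_two_add_two, Prod.fst_sub,
    Prod.snd_sub, Prod.smul_fst, Prod.smul_snd, Pi.sub_apply, Pi.smul_apply, Pi.single_eq_same,
    Pi.single_eq_of_ne n1, Pi.single_eq_of_ne n2, Pi.zero_apply, smul_eq_mul, mul_one, mul_zero,
    sub_zero]
  generalize v.1 k = b
  generalize v.1 (k + 1) = c
  generalize v.1 (k + 2) = a
  generalize v.2 k = y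
  generalize v.2 (k + 1) = z
  rw [show (-a + (b - W) - y) / 2 = -((a + (W - b) - y) / 2 + y) by ring,
    show (a + (b - W) - y) / 2 = -((-a + (W - b) - y) / 2 + y) by ring,
    show (a - (b - W) - y) / 2 = (a + (W - b) - y) / 2 by ring,
    show (-a - (b - W) - y) / 2 = (-a + (W - b) - y) / 2 by ring,
    show ((b - W) - c - z) / 2 = -((c + (W - b) - z) / 2 + z) by ring,
    show (-(b - W) + c - z) / 2 = (c + (W - b) - z) / 2 by ring,
    show ((b - W) + c - z) / 2 = -((-c + (W - b) - z) / 2 + z) by ring,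
    show (-(b - W) - c - z) / 2 = (-c + (W - b) - z) / 2 by ring]
  simp only [hodd]
  ring

/-! ### The finite part of the derivative at a nondegenerate triangle -/

/-- The derivative of `2 * triangleV` with respect to the angle `b`, as far as it comes from a
corner with angle `γ` between sides with angles `a` and `b`. -/
noncomputable def cornerPartial (γ a b : ℝ) : ℝ :=
  (Real.log |2 * Real.sin ((Real.pi + a - b - γ) / 2)|
    + Real.log |2 * Real.sin ((Real.pi - a - b - γ) / 2)|
    - Real.log |2 * Real.sin ((Real.pi - a + b - γ) / 2)|
    - Real.log |2 * Real.sin ((Real.pi + a + b - γ) / 2)|) / 2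

lemma cornerPartial_zero_right (γ a : ℝ) : cornerPartial γ a 0 = 0 := by
  simp only [cornerPartial, sub_zero, add_zero]; ring

/-- The sign comes from the identity
`sin A₃ * sin A₄ - sin A₂ * sin A₅ = sin b * sin γ` for the four arguments `A₂, …, A₅` of the
Lobachevsky function that involve `a` and `b`. -/
lemma cornerPartial_neg {γ a b : ℝ} (hγ : 0 < γ) (ha : 0 ≤ a) (hb : 0 < b)
    (hs : γ + b + a < Real.pi) : cornerPartial γ a b < 0 := by
  have s2 := Real.sin_pos_of_pos_of_lt_pi (x := (Real.pi + a - b - γ) / 2) (by linarith)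
    (by linarith)
  have s3 := Real.sin_pos_of_pos_of_lt_pi (x := (Real.pi - a + b - γ) / 2) (by linarith)
    (by linarith)
  have s4 := Real.sin_pos_of_pos_of_lt_pi (x := (Real.pi + a + b - γ) / 2) (by linarith)
    (by linarith)
  have s5 := Real.sin_pos_of_pos_of_lt_pi (x := (Real.pi - a - b - γ) / 2) (by linarith)
    (by linarith)
  have hbγ : 0 < Real.sin b * Real.sin γ := mul_pos
    (Real.sin_pos_of_pos_of_lt_pi hb (by linarith)) (Real.sin_pos_of_pos_of_lt_pi hγ (by linarith))
  have hprod : Real.sin ((Real.pi - a + b - γ) / 2) * Real.sin ((Real.pi + a + b - γ) / 2)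
      - Real.sin ((Real.pi + a - b - γ) / 2) * Real.sin ((Real.pi - a - b - γ) / 2)
      = Real.sin b * Real.sin γ := by
    have e1 := Real.two_mul_sin_mul_sin ((Real.pi - a + b - γ) / 2) ((Real.pi + a + b - γ) / 2)
    have e2 := Real.two_mul_sin_mul_sin ((Real.pi + a - b - γ) / 2) ((Real.pi - a - b - γ) / 2)
    have e3 := Real.two_mul_sin_mul_sin b γ
    rw [show (Real.pi - a + b - γ) / 2 - (Real.pi + a + b - γ) / 2 = -a by ring, Real.cos_neg,
      show (Real.pi - a + b - γ) / 2 + (Real.pi + a + b - γ) / 2 = Real.pi + (b - γ) by ring,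
      Real.cos_add] at e1
    rw [show (Real.pi + a - b - γ) / 2 - (Real.pi - a - b - γ) / 2 = a by ring,
      show (Real.pi + a - b - γ) / 2 + (Real.pi - a - b - γ) / 2 = Real.pi - (b + γ) by ring,
      Real.cos_pi_sub] at e2
    rw [Real.cos_pi, Real.sin_pi] at e1
    linarith
  have hlog := Real.log_lt_log (mul_pos (mul_pos two_pos s2) (mul_pos two_pos s5))
    (y := 2 * Real.sin ((Real.pi - a + b - γ) / 2) * (2 * Real.sin ((Real.pi + a + b - γ) / 2)))
    (by linarith)
  rw [Real.log_mul (x := 2 * _) (y := 2 * _) (by positivity) (by positivity),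
    Real.log_mul (x := 2 * _) (y := 2 * _) (by positivity) (by positivity)] at hlog
  unfold cornerPartial
  simp only [Real.log_abs]
  linarith

/-- The derivative of `triangleV` with respect to the angle `α k`, at a nondegenerate point. -/
noncomputable def sidePartial (x : TriangleAngles) (k : Fin 3) : ℝ :=
  (1 / 2) * (cornerPartial (x.2 k) (x.1 (k + 2)) (x.1 k)
    + cornerPartial (x.2 (k + 1)) (x.1 (k + 1)) (x.1 k))

lemma sidePartial_of_alpha_eq_zero {x : TriangleAngles} {k : Fin 3} (hk : x.1 k = 0) :
    sidePartial x k = 0 := by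
  simp [sidePartial, hk, cornerPartial_zero_right]

lemma sidePartial_neg {x : TriangleAngles} (hx : x ∈ weakDelta) (hr : IsNondegenerate x) {k : Fin 3}
    (hk : 0 < x.1 k) : sidePartial x k < 0 := by
  have h1 := cornerPartial_neg (hr k).1 (hx.1 (k + 2)) hk (hr k).2
  have h2 := hr (k + 1)
  rw [fin_three_add_one_add_two] at h2
  have h3 := cornerPartial_neg h2.1 (hx.1 (k + 1)) hk (by linarith [h2.2])
  unfold sidePartial
  linarith

lemma lobFinitePart_of_mem_Ioo {z : ℝ} (h0 : 0 < z) (h1 : z < Real.pi) (c : ℝ) :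
    lobFinitePart z c = -(c * Real.log |2 * Real.sin z|) :=
  if_neg (Real.sin_pos_of_pos_of_lt_pi h0 h1).ne'

lemma cornerSum_lobFinitePart_add {γ a b : ℝ} (hγ : 0 < γ) (ha : 0 ≤ a) (hb : 0 ≤ b)
    (hs : γ + b + a < Real.pi) (γ' a' b' α β : ℝ) :
    cornerSum lobFinitePart γ a b γ' (a' + α) (b' + β)
      = cornerSum lobFinitePart γ a b γ' a' b' + α * cornerPartial γ b a
        + β * cornerPartial γ a b := by
  have e2 := lobFinitePart_of_mem_Ioo (z := (Real.pi + a - b - γ) / 2) (by linarith) (by linarith)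
  have e3 := lobFinitePart_of_mem_Ioo (z := (Real.pi - a + b - γ) / 2) (by linarith) (by linarith)
  have e4 := lobFinitePart_of_mem_Ioo (z := (Real.pi + a + b - γ) / 2) (by linarith) (by linarith)
  have e5 := lobFinitePart_of_mem_Ioo (z := (Real.pi - a - b - γ) / 2) (by linarith) (by linarith)
  unfold cornerSum cornerPartial
  rw [show Real.pi + b - a - γ = Real.pi - a + b - γ by ring,
    show Real.pi - b - a - γ = Real.pi - a - b - γ by ring,
    show Real.pi - b + a - γ = Real.pi + a - b - γ by ring,
    show Real.pi + b + a - γ = Real.pi + a + b - γ by ring]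
  simp only [e2, e3, e4, e5]
  ring

/-- At a nondegenerate point the finite part depends affinely on the derivatives of the `α`. -/
lemma triangleSum_lobFinitePart_add_smul {x : TriangleAngles} (hx : x ∈ weakDelta)
    (hr : IsNondegenerate x) (v : TriangleAngles) (β : Fin 3 → ℝ) (W : ℝ) :
    triangleSum lobFinitePart x (v + W • (β, 0))
      = triangleSum lobFinitePart x v + W * ∑ k, β k * sidePartial x k := by
  unfold triangleSum sidePartial
  simp only [Prod.fst_add, Prod.snd_add, Prod.smul_fst, Prod.smul_snd, Pi.add_apply, Pi.smul_apply,
    Pi.zero_apply, smul_eq_mul, mul_zero, add_zero]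
  have h (i : Fin 3) := cornerSum_lobFinitePart_add (hr i).1 (hx.1 (i + 2)) (hx.1 i) (hr i).2
    (v.2 i) (v.1 (i + 2)) (v.1 i) (W * β (i + 2)) (W * β i)
  simp only [h, Fin.sum_univ_three]
  simp only [Fin.isValue, Fin.reduceAdd, zero_add]
  ring

/-! ### Shifting angle across an edge -/

lemma Delta_alpha_add_lt {x : TriangleAngles} (hx : x ∈ Delta) {j k : Fin 3} (hjk : j ≠ k) :
    x.1 j + x.1 k < Real.pi := by
  have h (i : Fin 3) : x.1 i + x.1 (i + 2) < Real.pi := by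
    linarith [hx.2.2.2 i, hx.2.1 i]
  have h0 := h 0
  have h1 := h 1
  have h2 := h 2
  simp only [Fin.isValue, Fin.reduceAdd, zero_add] at h0 h1 h2
  fin_cases j <;> fin_cases k <;> simp only [Fin.reduceFinMk, Fin.zero_eta, Fin.isValue, ne_eq,
    not_true_eq_false, Fin.mk_one] at hjk ⊢ <;> linarith

lemma IsCollapsed.not_isNondegenerate {x : TriangleAngles} {k : Fin 3} (h : IsCollapsed x k) :
    ¬ IsNondegenerate x := fun hr => (hr k).1.ne' h.2.2.2.1

lemma triangleSum_lobFinitePart_zero (x : TriangleAngles) : triangleSum lobFinitePart x 0 = 0 := by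
  have h (z : ℝ) : lobFinitePart z 0 = 0 := by simp [lobFinitePart]
  simp [triangleSum, cornerSum, h]

/-- A quantity that starts non-negative, and with non-negative derivative if it starts at `0`, stays
non-negative for a short while. -/
lemma eventually_add_mul_nonneg {a c : ℝ} (ha : 0 ≤ a) (hc : a = 0 → 0 ≤ c) :
    ∀ᶠ ε : ℝ in 𝓝[>] 0, 0 ≤ a + ε * c := by
  rcases ha.eq_or_lt with h | h
  · filter_upwards [eventually_mem_nhdsWithin] with ε hε
    have := mul_nonneg (le_of_lt hε) (hc h.symm)
    linarith
  · have : Tendsto (fun ε : ℝ => a + ε * c) (𝓝 0) (𝓝 (a + 0 * c)) := by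
      apply Continuous.tendsto; fun_prop
    rw [zero_mul, add_zero] at this
    exact ((this.eventually (lt_mem_nhds h)).filter_mono nhdsWithin_le_nhds).mono
      fun _ h => h.le

namespace TriangulatedSurface

variable {T : Type*}

lemma side_glue_congr (S : TriangulatedSurface T) {s s' : T × Fin 3 × Bool}
    (h : side s = side s') : side (S.glue s) = side (S.glue s') := by
  obtain ⟨t, k, b⟩ := s
  obtain ⟨t', k', b'⟩ := s'
  simp only [side, Prod.mk.injEq] at h
  obtain ⟨rfl, rfl⟩ := h
  rcases Bool.eq_or_eq_not b' b with rfl | rfl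
  · rfl
  · rw [S.glue_reverse t k b]
    rfl

lemma side_glue_eq_iff (S : TriangulatedSurface T) {s s' : T × Fin 3 × Bool} :
    side (S.glue s) = side (S.glue s') ↔ side s = side s' := by
  refine ⟨fun h => ?_, S.side_glue_congr⟩
  have := S.side_glue_congr h
  rwa [S.glue_glue, S.glue_glue] at this

open Classical in
/-- The direction in the space of angle systems that increases the angle at the side `s` and
decreases the angle at the side glued to `s`, both at unit speed. -/
noncomputable def edgeShift (S : TriangulatedSurface T) (s : T × Fin 3 × Bool) : AngleSpace T :=
  fun t => (fun j => (if (t, j) = side s then 1 else 0)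
    - (if (t, j) = side (S.glue s) then 1 else 0), 0)

open Classical in
lemma edgeShift_side (S : TriangulatedSurface T) (s s' : T × Fin 3 × Bool) :
    (S.edgeShift s s'.1).1 s'.2.1 = (if side s' = side s then 1 else 0)
      - (if side s' = side (S.glue s) then 1 else 0) := rfl

lemma edgeShift_snd (S : TriangulatedSurface T) (s : T × Fin 3 × Bool) (t : T) (i : Fin 3) :
    (S.edgeShift s t).2 i = 0 := rfl

lemma edgeShift_of_ne (S : TriangulatedSurface T) {s : T × Fin 3 × Bool} {t : T} (h : s.1 ≠ t)
    (h' : (S.glue s).1 ≠ t) : S.edgeShift s t = 0 := by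
  have h1 (j : Fin 3) : (t, j) ≠ side s := fun e => h (congrArg Prod.fst e).symm
  have h2 (j : Fin 3) : (t, j) ≠ side (S.glue s) := fun e => h' (congrArg Prod.fst e).symm
  ext j <;> simp [edgeShift, h1, h2]

lemma edgeShift_glue_fst (S : TriangulatedSurface T) {s : T × Fin 3 × Bool}
    (h : s.1 ≠ (S.glue s).1) :
    S.edgeShift s (S.glue s).1 = -(Pi.single (S.glue s).2.1 1, 0) := by
  have h1 (j : Fin 3) : ((S.glue s).1, j) ≠ side s := fun e => h (congrArg Prod.fst e).symm
  ext j
  · simp only [edgeShift, if_neg (h1 j)]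
    simp [side, Pi.single_apply]
  · simp [edgeShift]

lemma edgeShift_fst_nonneg (S : TriangulatedSurface T) {s : T × Fin 3 × Bool} {t : T} {j : Fin 3}
    (h : (t, j) ≠ side (S.glue s)) : 0 ≤ (S.edgeShift s t).1 j := by
  simp only [edgeShift, if_neg h, sub_zero]
  split_ifs <;> norm_num

lemma edgeShift_fst_nonpos (S : TriangulatedSurface T) {s : T × Fin 3 × Bool} {t : T}
    (h : s.1 ≠ t) (j : Fin 3) : (S.edgeShift s t).1 j ≤ 0 := by
  have h1 : (t, j) ≠ side s := fun e => h (congrArg Prod.fst e).symm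
  simp only [edgeShift, if_neg h1, zero_sub]
  split_ifs <;> norm_num

open Classical in
/-- If the angle at the side `s` vanishes, then to first order only the change of the angle at the
side glued to `s` matters. -/
lemma sum_edgeShift_mul_sidePartial (S : TriangulatedSurface T) {s : T × Fin 3 × Bool}
    {q : AngleSpace T} (hs : (q s.1).1 s.2.1 = 0) (t : T) :
    ∑ j, (S.edgeShift s t).1 j * sidePartial (q t) j
      = if (S.glue s).1 = t then -sidePartial (q t) (S.glue s).2.1 else 0 := by
  have h1 : ∑ j, (if (t, j) = side s then (1 : ℝ) else 0) * sidePartial (q t) j = 0 := by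
    refine Finset.sum_eq_zero fun j _ => ?_
    split_ifs with h
    · obtain ⟨rfl, rfl⟩ := Prod.mk.inj h
      rw [sidePartial_of_alpha_eq_zero hs, mul_zero]
    · rw [zero_mul]
  simp only [edgeShift, sub_mul, Finset.sum_sub_distrib, h1, zero_sub]
  simp only [side, Prod.mk.injEq]
  split_ifs with h
  · simp [h]
  · have h' : t ≠ (S.glue s).1 := fun e => h e.symm
    simp [h']

/-! ### Admissible directions and the closure of the set of coherent angle systems -/

variable [Fintype T] (S : TriangulatedSurface T)

open Classical in
/-- The linear equations in the definition of coherent angle systems. -/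
def IsCoherent (θ : S.Edge → ℝ) (Ξ : S.Vertex → ℝ) (p : AngleSpace T) : Prop :=
  (∀ s, S.glue s ≠ s →
    (p s.1).1 s.2.1 + (p (S.glue s).1).1 (S.glue s).2.1 = Real.pi - θ (S.edge (side s))) ∧
  (∀ s, S.glue s = s →
    0 < θ (S.edge (side s)) ∧ (p s.1).1 s.2.1 = Real.pi - θ (S.edge (side s))) ∧
  (∀ v : S.Vertex, ∑ c : T × Fin 3 with S.vertex c = v, (p c.1).2 c.2 = Ξ v)

open Classical in
/-- The homogeneous linear equations satisfied by differences of coherent angle systems. -/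
def IsBalanced (v : AngleSpace T) : Prop :=
  (∀ s, S.glue s ≠ s → (v s.1).1 s.2.1 + (v (S.glue s).1).1 (S.glue s).2.1 = 0) ∧
  (∀ s, S.glue s = s → (v s.1).1 s.2.1 = 0) ∧
  (∀ w : S.Vertex, ∑ c : T × Fin 3 with S.vertex c = w, (v c.1).2 c.2 = 0) ∧
  (∀ t, (v t).2 0 + (v t).2 1 + (v t).2 2 = 0)

/-- The angle systems that satisfy the non-strict versions of the inequalities for coherent angle
systems. -/
def weakAngleSystems (θ : S.Edge → ℝ) (Ξ : S.Vertex → ℝ) : Set (AngleSpace T) :=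
  {p | (∀ t, p t ∈ weakDelta) ∧ S.IsCoherent θ Ξ p}

/-- The directions `v` in which one can leave the point `q` without leaving the set of weak angle
systems. -/
def IsAdmissible (q v : AngleSpace T) : Prop :=
  S.IsBalanced v ∧ (∀ t i, (q t).1 i = 0 → 0 ≤ (v t).1 i) ∧
  (∀ t i, (q t).2 i = 0 → 0 ≤ (v t).2 i) ∧
  (∀ t i, (q t).2 i + (q t).1 i + (q t).1 (i + 2) = Real.pi →
    (v t).2 i + (v t).1 i + (v t).1 (i + 2) ≤ 0)

variable {S} {θ : S.Edge → ℝ} {Ξ : S.Vertex → ℝ}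

lemma coherentAngleSystems_subset_weakAngleSystems :
    S.coherentAngleSystems θ Ξ ⊆ S.weakAngleSystems θ Ξ :=
  fun _ hp => ⟨fun t => Delta_subset_weakDelta (hp.1 t), hp.2⟩

lemma IsCoherent.add_smul {q v : AngleSpace T} (hq : S.IsCoherent θ Ξ q) (hv : S.IsBalanced v)
    (ε : ℝ) : S.IsCoherent θ Ξ (q + ε • v) := by
  refine ⟨fun s hs => ?_, fun s hs => ⟨(hq.2.1 s hs).1, ?_⟩, fun w => ?_⟩
  · have h1 := hq.1 s hs
    have h2 := hv.1 s hs
    simp only [Pi.add_apply, Pi.smul_apply, Prod.fst_add, Prod.smul_fst, smul_eq_mul]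
    linear_combination h1 + ε * h2
  · have h1 := (hq.2.1 s hs).2
    have h2 := hv.2.1 s hs
    simp only [Pi.add_apply, Pi.smul_apply, Prod.fst_add, Prod.smul_fst, smul_eq_mul]
    linear_combination h1 + ε * h2
  · have h1 := hq.2.2 w
    have h2 := hv.2.2.1 w
    simp only [Pi.add_apply, Pi.smul_apply, Prod.snd_add, Prod.smul_snd, smul_eq_mul,
      Finset.sum_add_distrib, ← Finset.mul_sum]
    rw [h1, h2, mul_zero, add_zero]

lemma IsBalanced.add_smul {v w : AngleSpace T} (hv : S.IsBalanced v) (hw : S.IsBalanced w)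
    (W : ℝ) : S.IsBalanced (v + W • w) := by
  refine ⟨fun s hs => ?_, fun s hs => ?_, fun c => ?_, fun t => ?_⟩
  · have h1 := hv.1 s hs
    have h2 := hw.1 s hs
    simp only [Pi.add_apply, Pi.smul_apply, Prod.fst_add, Prod.smul_fst, smul_eq_mul]
    linear_combination h1 + W * h2
  · have h1 := hv.2.1 s hs
    have h2 := hw.2.1 s hs
    simp only [Pi.add_apply, Pi.smul_apply, Prod.fst_add, Prod.smul_fst, smul_eq_mul]
    linear_combination h1 + W * h2
  · have h1 := hv.2.2.1 c
    have h2 := hw.2.2.1 c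
    simp only [Pi.add_apply, Pi.smul_apply, Prod.snd_add, Prod.smul_snd, smul_eq_mul,
      Finset.sum_add_distrib, ← Finset.mul_sum]
    rw [h1, h2, mul_zero, add_zero]
  · have h1 := hv.2.2.2 t
    have h2 := hw.2.2.2 t
    simp only [Pi.add_apply, Pi.smul_apply, Prod.snd_add, Prod.smul_snd, smul_eq_mul]
    linear_combination h1 + W * h2

lemma IsAdmissible.add_smul {q v w : AngleSpace T} (hv : S.IsAdmissible q v)
    (hw : S.IsAdmissible q w) {W : ℝ} (hW : 0 ≤ W) : S.IsAdmissible q (v + W • w) := by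
  refine ⟨hv.1.add_smul hw.1 W, fun t i h => ?_, fun t i h => ?_, fun t i h => ?_⟩
  · exact add_nonneg (hv.2.1 t i h) (mul_nonneg hW (hw.2.1 t i h))
  · exact add_nonneg (hv.2.2.1 t i h) (mul_nonneg hW (hw.2.2.1 t i h))
  · have h1 := hv.2.2.2 t i h
    have h2 := mul_nonneg hW (neg_nonneg.mpr (hw.2.2.2 t i h))
    simp only [Pi.add_apply, Pi.smul_apply, Prod.snd_add, Prod.smul_snd, Prod.fst_add,
      Prod.smul_fst, smul_eq_mul]
    linarith

lemma isAdmissible_sub {p q : AngleSpace T} (hp : p ∈ S.weakAngleSystems θ Ξ)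
    (hq : q ∈ S.weakAngleSystems θ Ξ) : S.IsAdmissible q (p - q) := by
  obtain ⟨hp, cp⟩ := hp
  obtain ⟨hq, cq⟩ := hq
  refine ⟨⟨fun s hs => ?_, fun s hs => ?_, fun w => ?_, fun t => ?_⟩, fun t i h => ?_,
    fun t i h => ?_, fun t i h => ?_⟩ <;>
    simp only [Pi.sub_apply, Prod.snd_sub, Prod.fst_sub, Finset.sum_sub_distrib]
  · linear_combination cp.1 s hs - cq.1 s hs
  · linear_combination (cp.2.1 s hs).2 - (cq.2.1 s hs).2
  · rw [cp.2.2 w, cq.2.2 w, sub_self]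
  · linear_combination (hp t).2.2.1 - (hq t).2.2.1
  · rw [h, sub_zero]; exact (hp t).1 i
  · rw [h, sub_zero]; exact (hp t).2.1 i
  · linarith [(hp t).2.2.2 i]

lemma isAdmissible_edgeShift {q : AngleSpace T} {s : T × Fin 3 × Bool}
    (hr : IsNondegenerate (q s.1)) (hs : 0 < (q (S.glue s).1).1 (S.glue s).2.1) :
    S.IsAdmissible q (S.edgeShift s) := by
  have h1 (s' : T × Fin 3 × Bool) :
      side (S.glue s') = side (S.glue s) ↔ side s' = side s := S.side_glue_eq_iff
  have h2 (s' : T × Fin 3 × Bool) :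
      side (S.glue s') = side s ↔ side s' = side (S.glue s) := by
    rw [← S.side_glue_eq_iff, S.glue_glue]
  refine ⟨⟨fun s' _ => ?_, fun s' hs' => ?_, fun w => ?_, fun t => ?_⟩, fun t i h => ?_,
    fun t i h => ?_, fun t i h => ?_⟩
  · rw [edgeShift_side, edgeShift_side]
    have h3 := h1 s'
    have h4 := h2 s'
    split_ifs <;> first | (exfalso; tauto) | norm_num
  · have h3 := h2 s'
    rw [hs'] at h3
    rw [edgeShift_side]
    by_cases c1 : side s' = side s
    · rw [if_pos c1, if_pos (h3.mp c1), sub_self]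
    · rw [if_neg c1, if_neg (mt h3.mpr c1), sub_self]
  · simp [edgeShift_snd]
  · simp [edgeShift_snd]
  · refine S.edgeShift_fst_nonneg fun e => ?_
    obtain ⟨rfl, rfl⟩ := Prod.mk.inj e
    exact hs.ne' h
  · exact (S.edgeShift_snd s t i).ge
  · have hne : s.1 ≠ t := by
      rintro rfl
      exact (hr i).2.ne h
    rw [edgeShift_snd]
    linarith [S.edgeShift_fst_nonpos hne i, S.edgeShift_fst_nonpos hne (i + 2)]

lemma IsAdmissible.eventually_mem {q v : AngleSpace T} (hq : q ∈ S.weakAngleSystems θ Ξ)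
    (hv : S.IsAdmissible q v) : ∀ᶠ ε : ℝ in 𝓝[>] 0, q + ε • v ∈ S.weakAngleSystems θ Ξ := by
  obtain ⟨hq, cq⟩ := hq
  obtain ⟨bv, v1, v2, v3⟩ := hv
  have a1 : ∀ᶠ ε : ℝ in 𝓝[>] 0, ∀ t i, 0 ≤ (q t).1 i + ε * (v t).1 i :=
    eventually_all.mpr fun t => eventually_all.mpr fun i =>
      eventually_add_mul_nonneg ((hq t).1 i) (v1 t i)
  have a2 : ∀ᶠ ε : ℝ in 𝓝[>] 0, ∀ t i, 0 ≤ (q t).2 i + ε * (v t).2 i :=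
    eventually_all.mpr fun t => eventually_all.mpr fun i =>
      eventually_add_mul_nonneg ((hq t).2.1 i) (v2 t i)
  have a3 : ∀ᶠ ε : ℝ in 𝓝[>] 0, ∀ t i,
      0 ≤ (Real.pi - ((q t).2 i + (q t).1 i + (q t).1 (i + 2)))
        + ε * -((v t).2 i + (v t).1 i + (v t).1 (i + 2)) :=
    eventually_all.mpr fun t => eventually_all.mpr fun i =>
      eventually_add_mul_nonneg (sub_nonneg.mpr ((hq t).2.2.2 i))
        fun h => neg_nonneg.mpr (v3 t i (sub_eq_zero.mp h).symm)
  filter_upwards [a1, a2, a3] with ε b1 b2 b3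
  refine ⟨fun t => ⟨b1 t, b2 t, ?_, fun i => ?_⟩, cq.add_smul bv ε⟩
  · have h1 := (hq t).2.2.1
    have h2 := bv.2.2.2 t
    simp only [Pi.add_apply, Pi.smul_apply, Prod.snd_add, Prod.smul_snd, smul_eq_mul]
    linear_combination h1 + ε * h2
  · have := b3 t i
    simp only [Pi.add_apply, Pi.smul_apply, Prod.snd_add, Prod.smul_snd, Prod.fst_add,
      Prod.smul_fst, smul_eq_mul]
    linarith

lemma isClosed_weakAngleSystems : IsClosed (S.weakAngleSystems θ Ξ) := by
  simp only [weakAngleSystems, weakDelta, IsCoherent, Set.mem_ofPred_eq]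
  refine IsClosed.and ?_ (IsClosed.and ?_ (IsClosed.and ?_ ?_))
  · simp only [Set.ofPred_forall]
    refine isClosed_iInter fun t => IsClosed.and ?_ (IsClosed.and ?_ (IsClosed.and ?_ ?_))
    · simp only [Set.ofPred_forall]
      exact isClosed_iInter fun i => isClosed_le (by fun_prop) (by fun_prop)
    · simp only [Set.ofPred_forall]
      exact isClosed_iInter fun i => isClosed_le (by fun_prop) (by fun_prop)
    · exact isClosed_eq (by fun_prop) (by fun_prop)
    · simp only [Set.ofPred_forall]
      exact isClosed_iInter fun i => isClosed_le (by fun_prop) (by fun_prop)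
  · simp only [Set.ofPred_forall]
    exact isClosed_iInter fun s => isClosed_iInter fun _ =>
      isClosed_eq (by fun_prop) (by fun_prop)
  · simp only [Set.ofPred_forall]
    exact isClosed_iInter fun s => isClosed_iInter fun _ =>
      isClosed_const.and (isClosed_eq (by fun_prop) (by fun_prop))
  · simp only [Set.ofPred_forall]
    exact isClosed_iInter fun w => isClosed_eq (by fun_prop) (by fun_prop)

lemma isCompact_weakAngleSystems : IsCompact (S.weakAngleSystems θ Ξ) := by
  refine (isCompact_Icc (a := (fun _ => (fun _ => 0, fun _ => 0) : AngleSpace T))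
    (b := fun _ => (fun _ => Real.pi, fun _ => Real.pi))).of_isClosed_subset
    isClosed_weakAngleSystems fun q hq => ?_
  have h (t : T) (i : Fin 3) := (hq.1 t).2.2.2 i
  have h1 (t : T) (i : Fin 3) := (hq.1 t).1 i
  have h2 (t : T) (i : Fin 3) := (hq.1 t).2.1 i
  exact ⟨fun t => ⟨h1 t, h2 t⟩, fun t => ⟨fun i => by linarith [h t i, h1 t (i + 2), h2 t i],
    fun i => by linarith [h t i, h1 t (i + 2), h1 t i]⟩⟩

/-- If there is a coherent angle system, then the closure of their set is obtained by making the
inequalities non-strict. -/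
lemma closure_coherentAngleSystems (hA : (S.coherentAngleSystems θ Ξ).Nonempty) :
    closure (S.coherentAngleSystems θ Ξ) = S.weakAngleSystems θ Ξ := by
  refine Set.Subset.antisymm (closure_minimal coherentAngleSystems_subset_weakAngleSystems
    isClosed_weakAngleSystems) fun q hq => ?_
  obtain ⟨p, hp⟩ := hA
  have hadm := isAdmissible_sub (coherentAngleSystems_subset_weakAngleSystems hp) hq
  have hlim : Tendsto (fun ε : ℝ => q + ε • (p - q)) (𝓝[>] 0) (𝓝 q) := by
    have : Tendsto (fun ε : ℝ => q + ε • (p - q)) (𝓝 0) (𝓝 (q + (0 : ℝ) • (p - q))) := by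
      apply Continuous.tendsto; fun_prop
    rw [zero_smul, add_zero] at this
    exact this.mono_left nhdsWithin_le_nhds
  refine mem_closure_of_tendsto hlim ?_
  filter_upwards [Ioo_mem_nhdsGT (zero_lt_one (α := ℝ))] with ε hε
  -- A non-strict inequality at `q` and a strict one at `p` give a strict one in between.
  have hcomb {a b c : ℝ} (ha : a ≤ c) (hb : b < c) : a + ε * (b - a) < c := by
    nlinarith [mul_pos hε.1 (sub_pos.mpr hb), mul_nonneg (sub_nonneg.mpr hε.2.le)
      (sub_nonneg.mpr ha)]
  obtain ⟨hqt, cq⟩ := hq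
  refine ⟨fun t => ⟨fun i => ?_, fun i => ?_, ?_, fun i => ?_⟩, cq.add_smul hadm.1 ε⟩ <;>
    simp only [Pi.add_apply, Pi.smul_apply, Prod.snd_add, Prod.smul_snd, Prod.fst_add,
      Prod.smul_fst, smul_eq_mul, Pi.sub_apply, Prod.fst_sub, Prod.snd_sub]
  · have := hcomb (neg_nonpos.mpr ((hqt t).1 i)) (neg_neg_of_pos ((hp.1 t).1 i))
    linarith
  · have := hcomb (neg_nonpos.mpr ((hqt t).2.1 i)) (neg_neg_of_pos ((hp.1 t).2.1 i))
    linarith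
  · linear_combination (1 - ε) * (hqt t).2.2.1 + ε * (hp.1 t).2.2.1
  · have := hcomb ((hqt t).2.2.2 i) ((hp.1 t).2.2.2 i)
    linarith

lemma continuous_functionalF : Continuous (functionalF (T := T)) := by
  have := continuous_triangleV
  unfold functionalF
  fun_prop

/-! ### Points of the closure that are not maxima -/

/-- A point of the closure is not a maximum if the one-sided derivative of `functionalF` in an
admissible direction is `+∞`, or finite and positive. -/
lemma IsAdmissible.exists_functionalF_gt {q v : AngleSpace T} (hq : q ∈ S.weakAngleSystems θ Ξ)
    (hv : S.IsAdmissible q v)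
    (h : 0 < ∑ t, triangleSum lobLogPart (q t) (v t) ∨
      ∑ t, triangleSum lobLogPart (q t) (v t) = 0 ∧
        0 < ∑ t, triangleSum lobFinitePart (q t) (v t)) :
    ∃ q' ∈ S.weakAngleSystems θ Ξ, functionalF q < functionalF q' := by
  set K := ∑ t, triangleSum lobLogPart (q t) (v t) with hK
  set R := ∑ t, triangleSum lobFinitePart (q t) (v t) with hR
  have hlim : Tendsto (fun ε : ℝ => (functionalF (q + ε • v) - functionalF q) / ε
      + K * Real.log ε) (𝓝[>] 0) (𝓝 R) := by
    refine (tendsto_finsetSum Finset.univ fun t _ =>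
      tendsto_triangleV_slope (q t) (v t)).congr fun ε => ?_
    simp only [functionalF, hK]
    rw [Finset.sum_add_distrib, ← Finset.sum_div, Finset.sum_sub_distrib, Finset.sum_mul]
    rfl
  have hpos : ∀ᶠ ε : ℝ in 𝓝[>] 0, 0 < (functionalF (q + ε • v) - functionalF q) / ε := by
    rcases h with h | ⟨h, h'⟩
    · have h1 : Tendsto (fun ε : ℝ => -(K * Real.log ε)) (𝓝[>] 0) atTop :=
        tendsto_neg_atBot_atTop.comp (Real.tendsto_log_nhdsGT_zero.const_mul_atBot h)
      filter_upwards [(hlim.add_atTop h1).eventually_gt_atTop 0] with ε hε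
      linarith
    · rw [h] at hlim
      filter_upwards [hlim.eventually (lt_mem_nhds h')] with ε hε
      linarith
  obtain ⟨ε, h1, h2, h3⟩ := (hpos.and ((hv.eventually_mem hq).and
    (eventually_mem_nhdsWithin (a := (0 : ℝ)) (s := Set.Ioi 0)))).exists
  refine ⟨_, h2, ?_⟩
  have := (div_pos_iff_of_pos_right h3).mp h1
  linarith

/-- If some triangles are collapsed, then one of them is glued, along the side with angle `π`, to a
nondegenerate triangle. In the chain of triangles obtained by crossing the sides with angle `π`,
the angles at these sides in any coherent angle system `p` strictly decrease, so the chain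
must leave the set of collapsed triangles. -/
lemma exists_isCollapsed_glue_isNondegenerate {p q : AngleSpace T}
    (hθ : ∀ e, 0 ≤ θ e) (hp : p ∈ S.coherentAngleSystems θ Ξ) (hq : q ∈ S.weakAngleSystems θ Ξ)
    (hall : ∀ t, IsNondegenerate (q t) ∨ ∃ k, IsCollapsed (q t) k)
    (hex : ∃ t k, IsCollapsed (q t) k) :
    ∃ s : T × Fin 3 × Bool, IsNondegenerate (q s.1) ∧ (q s.1).1 s.2.1 = 0 ∧
      IsCollapsed (q (S.glue s).1) (S.glue s).2.1 := by
  obtain ⟨⟨t, k⟩, hc, hmin⟩ := Set.exists_min_image {c : T × Fin 3 | IsCollapsed (q c.1) c.2}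
    (fun c => (p c.1).1 c.2) (Set.toFinite _) (by
      obtain ⟨t, k, h⟩ := hex
      exact ⟨(t, k), h⟩)
  have hc : IsCollapsed (q t) k := hc
  have hg : S.glue (t, k, true) ≠ (t, k, true) := by
    intro h
    have h1 := hq.2.2.1 _ h
    have h2 : (q t).1 k = _ := h1.2
    rw [hc.1] at h2
    linarith [h1.1]
  have eq1 : (q t).1 k + _ = _ := hq.2.1 _ hg
  have ep1 : (p t).1 k + _ = _ := hp.2.1 _ hg
  set e := S.edge (side (t, k, true))
  set s := S.glue (t, k, true) with hs
  have hgs : S.glue s = (t, k, true) := S.glue_glue _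
  have h0 := (hq.1 s.1).1 s.2.1
  rw [hc.1] at eq1
  have hs0 : (q s.1).1 s.2.1 = 0 := by linarith [hθ e]
  refine ⟨s, (hall s.1).resolve_right ?_, hs0, by rw [hgs]; exact hc⟩
  rintro ⟨k', hc'⟩
  -- Two sides of the triangle `s.1`: `s`, with angle `0` at `q`, and the side `k'` with angle `π`.
  have hne : k' ≠ s.2.1 := by
    intro h
    have := hc'.1
    rw [h, hs0] at this
    exact Real.pi_ne_zero this.symm
  have h1 := Delta_alpha_add_lt (hp.1 s.1) hne
  have h2 : (p t).1 k ≤ (p s.1).1 k' := hmin (s.1, k') hc'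
  linarith [hθ e]

/-- No point of the closure outside the set of coherent angle systems is a maximum. -/
lemma exists_functionalF_gt {q : AngleSpace T} (hθ : ∀ e, 0 ≤ θ e ∧ θ e < Real.pi)
    (hA : (S.coherentAngleSystems θ Ξ).Nonempty) (hq : q ∈ S.weakAngleSystems θ Ξ)
    (hqA : q ∉ S.coherentAngleSystems θ Ξ) :
    ∃ q' ∈ S.weakAngleSystems θ Ξ, functionalF q < functionalF q' := by
  classical
  obtain ⟨p, hp⟩ := hA
  have hadm := isAdmissible_sub (coherentAngleSystems_subset_weakAngleSystems hp) hq
  by_cases hall : ∀ t, IsNondegenerate (q t) ∨ ∃ k, IsCollapsed (q t) k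
  swap
  · -- A triangle is degenerate but not collapsed: infinite derivative towards `p`.
    push Not at hall
    obtain ⟨t, h1, h2⟩ := hall
    refine hadm.exists_functionalF_gt hq (Or.inl (Finset.sum_pos' (fun t' _ => ?_)
      ⟨t, Finset.mem_univ t, triangleSum_lobLogPart_pos (hq.1 t) (hp.1 t) h1 h2⟩))
    by_cases h3 : IsNondegenerate (q t')
    · exact (triangleSum_lobLogPart_of_isNondegenerate (hq.1 t') h3 _).ge
    · by_cases h4 : ∃ k, IsCollapsed (q t') k
      · exact (triangleSum_lobLogPart_of_isCollapsed h4.choose_spec (hadm.1.2.2.2 t')).ge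
      · push Not at h4
        exact (triangleSum_lobLogPart_pos (hq.1 t') (hp.1 t') h3 h4).le
  have hlog {v : AngleSpace T} (hv : S.IsAdmissible q v) :
      ∑ t, triangleSum lobLogPart (q t) (v t) = 0 := by
    refine Finset.sum_eq_zero fun t _ => ?_
    rcases hall t with h | ⟨k, h⟩
    · exact triangleSum_lobLogPart_of_isNondegenerate (hq.1 t) h _
    · exact triangleSum_lobLogPart_of_isCollapsed h (hv.1.2.2.2 t)
  by_cases hex : ∃ t k, IsCollapsed (q t) k
  · -- Move towards `p`, and at the same time decrease the angle `π` of a collapsed triangle at a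
    -- large speed `W`.
    obtain ⟨s, hs, hs0, hcol⟩ :=
      exists_isCollapsed_glue_isNondegenerate (fun e => (hθ e).1) hp hq hall hex
    have hne : s.1 ≠ (S.glue s).1 := fun h => hcol.not_isNondegenerate (h ▸ hs)
    have hshift := isAdmissible_edgeShift (S := S) hs (by rw [hcol.1]; exact Real.pi_pos)
    have hother (W : ℝ) {t : T} (ht : t ≠ (S.glue s).1) :
        triangleSum lobFinitePart (q t) ((p - q + W • S.edgeShift s) t)
          = triangleSum lobFinitePart (q t) ((p - q) t) := by
      rcases hall t with h | ⟨k, h⟩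
      · have := triangleSum_lobFinitePart_add_smul (hq.1 t) h ((p - q) t) (S.edgeShift s t).1 W
        rw [S.sum_edgeShift_mul_sidePartial hs0, if_neg ht.symm, mul_zero, add_zero] at this
        exact this
      · have hst : s.1 ≠ t := by
          rintro rfl
          exact h.not_isNondegenerate hs
        rw [Pi.add_apply, Pi.smul_apply, S.edgeShift_of_ne hst ht.symm, smul_zero, add_zero]
    have hmain := tendsto_triangleSum_lobFinitePart_of_isCollapsed hcol
      (v := (p - q) (S.glue s).1)
      (by simpa [hcol.2.2.2.1] using (hp.1 (S.glue s).1).2.1 _)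
      (by simpa [hcol.2.2.2.2.1] using (hp.1 (S.glue s).1).2.1 _)
    have hsum := tendsto_atTop_add_const_right atTop
      (∑ t ∈ Finset.univ.erase (S.glue s).1, triangleSum lobFinitePart (q t) ((p - q) t)) hmain
    obtain ⟨W, hW, hW0⟩ := ((hsum.eventually_gt_atTop 0).and (eventually_ge_atTop 0)).exists
    refine (hadm.add_smul hshift hW0).exists_functionalF_gt hq
      (Or.inr ⟨hlog (hadm.add_smul hshift hW0), ?_⟩)
    rw [← Finset.add_sum_erase _ _ (Finset.mem_univ (S.glue s).1),
      Finset.sum_congr rfl fun t ht => hother W (Finset.ne_of_mem_erase ht), Pi.add_apply,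
      Pi.smul_apply, S.edgeShift_glue_fst hne, smul_neg, ← sub_eq_add_neg]
    exact hW
  · -- All triangles are nondegenerate, so some angle at a side vanishes; increase it.
    have hnd (t : T) : IsNondegenerate (q t) :=
      (hall t).resolve_right fun ⟨k, h⟩ => hex ⟨t, k, h⟩
    obtain ⟨t, k, hk⟩ : ∃ t k, (q t).1 k = 0 := by
      by_contra! hne
      exact hqA ⟨fun t => ⟨fun i => ((hq.1 t).1 i).lt_of_ne' (hne t i), fun i => (hnd t i).1,
        (hq.1 t).2.2.1, fun i => (hnd t i).2⟩, hq.2⟩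
    set s : T × Fin 3 × Bool := (t, k, true) with hs
    have hs0 : (q s.1).1 s.2.1 = 0 := hk
    have hg : S.glue s ≠ s := by
      intro h
      have := (hq.2.2.1 s h).2
      rw [hs0] at this
      linarith [(hθ (S.edge (side s))).2]
    have hpos : 0 < (q (S.glue s).1).1 (S.glue s).2.1 := by
      have := hq.2.1 s hg
      rw [hs0] at this
      linarith [(hθ (S.edge (side s))).2]
    have hshift := isAdmissible_edgeShift (hnd s.1) hpos
    refine hshift.exists_functionalF_gt hq (Or.inr ⟨hlog hshift, ?_⟩)
    have hval (t : T) : triangleSum lobFinitePart (q t) (S.edgeShift s t)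
        = if (S.glue s).1 = t then -sidePartial (q t) (S.glue s).2.1 else 0 := by
      have := triangleSum_lobFinitePart_add_smul (hq.1 t) (hnd t) 0 (S.edgeShift s t).1 1
      rw [S.sum_edgeShift_mul_sidePartial hs0, zero_add, one_smul, one_mul,
        triangleSum_lobFinitePart_zero, zero_add] at this
      exact this
    simp only [hval, Finset.sum_ite_eq, Finset.mem_univ, if_true]
    exact neg_pos.mpr (sidePartial_neg (hq.1 _) (hnd _) hpos)

end TriangulatedSurface

theorem lemma3p3 {T : Type*} [Fintype T] (S : TriangulatedSurface T)
    (θ : S.Edge → ℝ) (Ξ : S.Vertex → ℝ)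
    (hθ : ∀ e, 0 ≤ θ e ∧ θ e < Real.pi) (hΞ : ∀ v, 0 < Ξ v)
    (hA : (S.coherentAngleSystems θ Ξ).Nonempty) :
    ∃ p ∈ S.coherentAngleSystems θ Ξ,
      (∀ q ∈ closure (S.coherentAngleSystems θ Ξ), functionalF q ≤ functionalF p) ∧
      (∀ q ∈ closure (S.coherentAngleSystems θ Ξ) \ S.coherentAngleSystems θ Ξ,
        functionalF q < functionalF p) := by
  rw [TriangulatedSurface.closure_coherentAngleSystems hA]
  obtain ⟨p, hp, hmax⟩ := TriangulatedSurface.isCompact_weakAngleSystems.exists_isMaxOn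
    (hA.mono TriangulatedSurface.coherentAngleSystems_subset_weakAngleSystems)
    (TriangulatedSurface.continuous_functionalF (T := T)).continuousOn
  have hmax' : ∀ q ∈ S.weakAngleSystems θ Ξ, functionalF q ≤ functionalF p := hmax
  refine ⟨p, ?_, hmax', fun q hq => ?_⟩
  · by_contra hpA
    obtain ⟨q', hq', hlt⟩ := TriangulatedSurface.exists_functionalF_gt hθ hA hp hpA
    exact (hmax' q' hq').not_gt hlt
  · obtain ⟨q', hq', hlt⟩ := TriangulatedSurface.exists_functionalF_gt hθ hA hq.1 hq.2
    exact hlt.trans_le (hmax' q' hq')
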